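/- **Setting.** Let $\lambda\ge 0$ and let $\hat H,\check H$ be symmetric, nonnegative, measurable functions on $(0,\infty)^2$, homogeneous of degree $\lambda$ (i.e. $H(ax,ay)=a^\lambda H(x,y)$ for $a,x,y>0$), with $$\sup_{0<u<1}\hat H(u,1-u)\in(0,\infty),\qquad \int_0^1\check H(u,1-u)\,du\in(0,\infty).$$ Let $\Omega$ be the set of sequences $\mathbf z=(z_i)_{i\ge1}$ with $z_1\ge z_2\ge\dots\ge0$ and $\sum_i z_i<\infty$ (the zero sequence, on which the operators below vanish, is included). For $N=1,2,\dots$ let $$L^N\Phi(\mathbf z)=\frac1{2N}\sum_{i\ne j}z_iz_j\hat H(z_i,z_j)\bigl(\Phi(M_{ij}\mathbf z)-\Phi(\mathbf z)\bigr)+\frac12\sum_i z_i\int_0^{z_i}\check H(y,z_i-y)\bigl(\Phi(S_i^{(y)}\mathbf z)-\Phi(\mathbf z)\bigr)\,dy,$$ where $M_{ij}\mathbf z$ is obtained from $\mathbf z$ by merging $z_i$ and $z_j$ into $z_i+z_j$, and $S^{(y)}_i\mathbf z$ by splitting $z_i$ into $y$ and $z_i-y$, followed in both cases by reordering; terms with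 $z_iz_j=0$, resp. $z_i=0$, are $0$. Let $Z^N=(Z^N(t))_{t\ge0}$, $Z^N(t)=(Z^N_i(t))_{i\ge1}$, be an $\Omega$-valued jump process (piecewise constant right-continuous paths with finitely many jumps in bounded time intervals) generated by $L^N$: for every bounded Borel $\Phi$ on $\Omega$ such that $L^N\Phi$ is bounded, $\Phi(Z^N(t))-\Phi(Z^N(0))-\int_0^tL^N\Phi(Z^N(s))\,ds$ is a martingale. Put $$\mu^N(t)=\frac1N\sum_iZ^N_i(t)\,\delta_{Z^N_i(t)},$$ regarded as a measure on $(0,\infty)$. For $a,b,\gamma>0$ let $\mathcal M^{\gamma}_{a,b}$ be the set of finite measures $\nu$ on $(0,\infty)$ with $\nu((0,\infty))\le a$ and $\int y^\gamma\,\nu(dy)\le b$. **Proposition.** Let $\delta>1$ and let $c_0$ be a locally finite measure on $(0,\infty)$ with $$0<\int x\,c_0(dx)<\infty\qquad\text{and}\qquad\int x^{2+\lambda+\delta}\,c_0(dx)<\infty .$$ Suppose that for each $N=1,2,\dots$ the point configuration $\sum_{i:\,Z^N_i(0)>0}\delta_{Z^N_i(0)}$ is a Poisson point process on $(0,\infty)$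 with mean measure $Nc_0$. Then for any $T>0$ and $\epsilon\in(0,1)$ there exist $a,b>0$ such that $$\inf_{N\ge1}P\bigl(\mu^N(t)\in\mathcal M^{\delta-1}_{a,b}\ \text{ for all }t\in[0,T]\bigr)\ge1-\epsilon .$$ -/

import Mathlib

open MeasureTheory ProbabilityTheory Set Filter Topology
open scoped NNReal ENNReal

noncomputable section

namespace CoagFrag

/-- The open half-line `(0, ∞)` of cluster sizes. -/
abbrev Pos : Type := Ioi (0 : ℝ)

/-- A symmetric, nonnegative, measurable function on `(0,∞)²` that is homogeneous of degree
`lam`. Values outside `(0,∞)²` are irrelevant. -/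
structure IsHomogeneousKernel (lam : ℝ) (H : ℝ → ℝ → ℝ) : Prop where
  measurable : Measurable (fun p : Pos × Pos => H p.1 p.2)
  symm : ∀ x y : ℝ, 0 < x → 0 < y → H x y = H y x
  nonneg : ∀ x y : ℝ, 0 < x → 0 < y → 0 ≤ H x y
  homog : ∀ a x y : ℝ, 0 < a → 0 < x → 0 < y → H (a * x) (a * y) = a ^ lam * H x y

/-- Condition on the coagulation kernel: `sup {H(u,1-u) : 0 < u < 1}` lies in `(0,∞)`. -/
structure IsCoagKernel (lam : ℝ) (H : ℝ → ℝ → ℝ) : Prop extends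
    IsHomogeneousKernel lam H where
  bdd : BddAbove ((fun u : ℝ => H u (1 - u)) '' Ioo 0 1)
  sup_pos : 0 < sSup ((fun u : ℝ => H u (1 - u)) '' Ioo 0 1)

/-- Condition on the fragmentation kernel: `∫₀¹ H(u,1-u) du` lies in `(0,∞)`. -/
structure IsFragKernel (lam : ℝ) (H : ℝ → ℝ → ℝ) : Prop extends
    IsHomogeneousKernel lam H where
  integrable : IntegrableOn (fun u : ℝ => H u (1 - u)) (Ioo 0 1) volume
  integral_pos : 0 < ∫ u in Ioo (0 : ℝ) 1, H u (1 - u)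

/-- The state space: nonincreasing sequences `z₁ ≥ z₂ ≥ ⋯ ≥ 0` with finite sum. The zero
sequence (no cluster at all, an absorbing state) is included. -/
def Config : Set (ℕ → ℝ) := {z | Antitone z ∧ (∀ i, 0 ≤ z i) ∧ Summable z}

/-- Decreasing rearrangement of a nonnegative sequence tending to zero: the `n`-th term
(counting from `0`) is the least `x ≥ 0` such that at most `n` terms of `a` exceed `x`. -/
def rearrange (a : ℕ → ℝ) (n : ℕ) : ℝ :=
  sInf {x : ℝ | 0 ≤ x ∧ {k : ℕ | x < a k}.encard ≤ (n : ℕ∞)}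

/-- `M_{ij} z`, for `i ≠ j`: merge the clusters `z i` and `z j` into one cluster of size
`z i + z j`, then reorder. -/
def merge (i j : ℕ) (z : ℕ → ℝ) : ℕ → ℝ :=
  rearrange (Function.update (Function.update z i (z i + z j)) j 0)

/-- `S_i^{(y)} z`, for `0 < y < z i`: split the cluster `z i` into `y` and `z i - y`, then
reorder. Before reordering, `y` is put in front and `z i` is replaced by `z i - y`. -/
def split (i : ℕ) (y : ℝ) (z : ℕ → ℝ) : ℕ → ℝ :=
  rearrange fun k => Nat.casesOn k y (Function.update z i (z i - y))

/-- The generator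
`L^N Φ(z) = (1/2N) ∑_{i≠j} z_i z_j Ĥ(z_i,z_j) (Φ(M_{ij} z) - Φ(z))
  + (1/2) ∑_i z_i ∫₀^{z_i} Ȟ(y, z_i - y) (Φ(S_i^{(y)} z) - Φ(z)) dy`.
Terms with `z_i z_j = 0`, respectively `z_i = 0`, vanish because of their prefactor. -/
def gen (N : ℕ) (Hh Hc : ℝ → ℝ → ℝ) (Φ : (ℕ → ℝ) → ℝ) (z : ℕ → ℝ) : ℝ :=
  1 / (2 * (N : ℝ)) * (∑' p : ℕ × ℕ, if p.1 = p.2 then 0 else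
      z p.1 * z p.2 * Hh (z p.1) (z p.2) * (Φ (merge p.1 p.2 z) - Φ z))
  + 1 / 2 * ∑' i : ℕ, z i * ∫ y in (0 : ℝ)..z i,
      Hc y (z i - y) * (Φ (split i y z) - Φ z)

/-- A path of a jump process: piecewise constant, right-continuous, with finitely many jumps
in bounded time intervals. -/
def IsStepPath {S : Type*} (x : ℝ≥0 → S) : Prop :=
  ∃ τ : ℕ → ℝ≥0, StrictMono τ ∧ τ 0 = 0 ∧ Tendsto τ atTop atTop ∧
    ∀ n, ∀ t ∈ Ico (τ n) (τ (n + 1)), x t = x (τ n)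

/-- `Z` is a Markov jump process on the state space generated by `L^N`, relative to the
filtration `ℱ`, in the sense of the martingale problem: for each bounded Borel function `Φ` on
the state space such that `L^N Φ` is bounded,
`Φ(Z(t)) - Φ(Z(0)) - ∫₀ᵗ L^N Φ(Z(s)) ds` is a martingale. -/
structure IsCoagFragProcess {W : Type*} {mW : MeasurableSpace W} (N : ℕ)
    (Hh Hc : ℝ → ℝ → ℝ) (ℱ : Filtration ℝ≥0 mW) (P : Measure W)
    (Z : ℝ≥0 → W → ℕ → ℝ) : Prop where
  mem_config : ∀ t w, Z t w ∈ Config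
  adapted : ∀ t, Measurable[ℱ t] (Z t)
  step_path : ∀ w, IsStepPath (fun t => Z t w)
  martingale : ∀ Φ : (ℕ → ℝ) → ℝ, Measurable Φ →
    (∃ C, ∀ z ∈ Config, |Φ z| ≤ C) → (∃ C, ∀ z ∈ Config, |gen N Hh Hc Φ z| ≤ C) →
    Martingale (fun (t : ℝ≥0) w => Φ (Z t w) - Φ (Z 0 w)
      - ∫ s in (0 : ℝ)..t, gen N Hh Hc Φ (Z s.toNNReal w)) ℱ P

/-- The point configuration `∑_{i : z_i > 0} δ_{z_i}` on `(0,∞)`: pulling back from `ℝ` to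
`(0,∞)` discards the atoms at `0`. -/
def pointMeasure (z : ℕ → ℝ) : Measure Pos :=
  (Measure.sum fun i => Measure.dirac (z i)).comap Subtype.val

/-- The measure `μ^N = (1/N) ∑_i z_i δ_{z_i}` on `(0,∞)`. -/
def empirical (N : ℕ) (z : ℕ → ℝ) : Measure Pos :=
  (Measure.sum fun i =>
    ENNReal.ofReal (z i / (N : ℝ)) • Measure.dirac (z i)).comap Subtype.val

/-- The moment `⟨ψ_γ, ν⟩ = ∫ y^γ ν(dy)`, with values in `[0,∞]`. -/
def moment (γ : ℝ) (ν : Measure Pos) : ℝ≥0∞ := ∫⁻ y, ENNReal.ofReal ((y : ℝ) ^ γ) ∂ν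

/-- `M^γ_{a,b}`: the finite measures on `(0,∞)` with total mass at most `a` and `γ`-th moment
at most `b`. -/
def boundedSet (a b γ : ℝ) : Set (Measure Pos) :=
  {ν | IsFiniteMeasure ν ∧ ν univ ≤ ENNReal.ofReal a ∧ moment γ ν ≤ ENNReal.ofReal b}

/-- `ξ` is a Poisson point process on `(0,∞)` with mean measure `m`: the numbers of points in
pairwise disjoint Borel sets are independent, and the number of points in a Borel set `B` with
`m B < ∞` has the Poisson distribution with parameter `m B`. -/
structure IsPoissonProcess {W : Type*} [MeasurableSpace W] (ξ : W → Measure Pos)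
    (m : Measure Pos) (P : Measure W) : Prop where
  measurable : Measurable ξ
  indep : ∀ (n : ℕ) (B : Fin n → Set Pos), (∀ i, MeasurableSet (B i)) →
    Pairwise (fun i j => Disjoint (B i) (B j)) → iIndepFun (fun i w => ξ w (B i)) P
  law : ∀ B : Set Pos, MeasurableSet B → m B ≠ ∞ →
    P.map (fun w => ξ w B) =
      (poissonMeasure (m B).toNNReal).map (fun k : ℕ => (k : ℝ≥0∞))

end CoagFrag

end

/-! Write $S_p=\sum_i z_i^p$. The mass of $\mu^N$ is $S_1/N$, which every jump preserves, and its
moment of order $\delta-1$ is $S_\delta/N$. So it suffices to control $S_1$ at time $0$ and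
$S_\delta$ uniformly on $[0,T]$.

Coagulation raises $S_\delta/N$ at a rate at most a constant times
$(S_1/N)(S_{\lambda+\delta+1}/N)$. Fragmentation lowers it at rate exactly $\kappa
S_{\lambda+\delta+2}/(2N)$, with $\kappa>0$ because $\delta>1$. When $S_1\le NA$, interpolating
$S_{\lambda+\delta+1}$ between $S_{\lambda+\delta+2}$ and $S_1$ lets the loss absorb the gain up to
a constant independent of $N$ (`exists_gen_cutPowSum_le`).

The martingale property is available only for bounded $\Phi$ with bounded $L^N\Phi$. Hence the test
function `cutPowSum`: it is $S_\delta/(Nb)$ while $S_1\le NA$ and $1$ otherwise. Since $S_1$ is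
conserved, the cut-off adds no drift, and $\Phi<1$ forces membership in $\mathcal
M^{\delta-1}_{A,b}$. A drift at most $C/b$ makes $\Phi(Z^N)$ dominated by a nonnegative martingale,
so Doob's inequality bounds the probability of ever reaching $1$ by $E\,\Phi(Z^N(0))+(C/b)(T+1)$
(`IsCoagFragProcess.measure_exists_one_le_le`). Campbell's formula bounds the initial mean, and
large $A$, then large $b$, finish the proof. -/

namespace CoagFrag

/-! ### Decreasing rearrangement and power sums. -/

theorem rearrange_nonneg (a : ℕ → ℝ) (n : ℕ) : 0 ≤ rearrange a n :=
  Real.sInf_nonneg fun _ hx => hx.1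

/-- The infimum is attained: if $n+1$ terms exceed $x$, the least of them is a lower bound for all
admissible levels and is still greater than $x$. -/
theorem rearrange_le_iff {a : ℕ → ℝ} (ha : BddAbove (range a)) {x : ℝ} (hx : 0 ≤ x) (n : ℕ) :
    rearrange a n ≤ x ↔ {k : ℕ | x < a k}.encard ≤ (n : ℕ∞) := by
  constructor
  · intro h
    by_contra! hcon
    have h1 : ((n + 1 : ℕ) : ℕ∞) ≤ {k : ℕ | x < a k}.encard := by
      push_cast
      exact Order.add_one_le_of_lt hcon
    obtain ⟨t, hts, htc⟩ := Set.exists_subset_encard_eq h1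
    have htf : t.Finite := Set.finite_of_encard_eq_coe htc
    have htn : t.Nonempty := by
      rw [← Set.encard_ne_zero, htc]
      simp
    obtain ⟨k₀, hk₀, hmin⟩ := Set.exists_min_image t a htf htn
    obtain ⟨B, hB⟩ := ha
    have hne : {x : ℝ | 0 ≤ x ∧ {k : ℕ | x < a k}.encard ≤ (n : ℕ∞)}.Nonempty := by
      refine ⟨max B 0, le_max_right _ _, ?_⟩
      have : {k : ℕ | max B 0 < a k} = ∅ := by
        ext k
        simp only [mem_ofPred_eq, mem_empty_iff_false, iff_false, not_lt]
        exact (hB ⟨k, rfl⟩).trans (le_max_left _ _)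
      rw [this]
      simp
    have h2 : a k₀ ≤ rearrange a n := by
      refine le_csInf hne fun y hy => ?_
      by_contra! hlt
      have hsub : t ⊆ {k | y < a k} := fun k hk => hlt.trans_le (hmin k hk)
      have := (Set.encard_le_encard hsub).trans hy.2
      rw [htc] at this
      exact absurd (Nat.cast_le.mp this) (by omega)
    exact absurd ((hts hk₀ : x < a k₀).trans_le h2) (not_lt.mpr h)
  · intro h
    exact csInf_le ⟨0, fun _ hy => hy.1⟩ ⟨hx, h⟩

theorem encard_lt_rearrange {a : ℕ → ℝ} (ha : BddAbove (range a)) {x : ℝ} (hx : 0 ≤ x) :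
    {n : ℕ | x < rearrange a n}.encard = {k : ℕ | x < a k}.encard := by
  have h : {n : ℕ | x < rearrange a n} = {n : ℕ | (n : ℕ∞) < {k : ℕ | x < a k}.encard} := by
    ext n
    simp only [mem_ofPred_eq]
    rw [← not_le, rearrange_le_iff ha hx, not_le]
  rw [h]
  generalize {k : ℕ | x < a k}.encard = c
  induction c using ENat.recTopCoe with
  | top => simp [Set.encard_univ]
  | coe m =>
    have : {n : ℕ | (n : ℕ∞) < (m : ℕ∞)} = (Finset.range m : Set ℕ) := by
      ext n
      simp
    rw [this, Set.encard_coe_eq_coe_finsetCard, Finset.card_range]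

/-- The power sum `∑ zᵢ ^ p`, with values in `[0,∞]`. -/
noncomputable def powSum (p : ℝ) (z : ℕ → ℝ) : ℝ≥0∞ := ∑' i, ENNReal.ofReal (z i ^ p)

theorem measurable_powSum (p : ℝ) : Measurable (powSum p) := by
  unfold powSum
  exact Measurable.tsum fun i => by fun_prop

/-- By the layer-cake formula a power sum depends only on the number of terms above each level,
which reordering preserves. -/
theorem powSum_rearrange {p : ℝ} (hp : 0 < p) {a : ℕ → ℝ} (ha : BddAbove (range a))
    (ha0 : ∀ k, 0 ≤ a k) : powSum p (rearrange a) = powSum p a := by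
  have key : ∀ b : ℕ → ℝ, (∀ k, 0 ≤ b k) → powSum p b = ENNReal.ofReal p *
      ∫⁻ t in Ioi 0, Measure.count {k : ℕ | t < b k} * ENNReal.ofReal (t ^ (p - 1)) := by
    intro b hb
    rw [← lintegral_rpow_eq_lintegral_meas_lt_mul Measure.count (Eventually.of_forall hb)
      (measurable_of_countable b).aemeasurable hp, lintegral_count]
    rfl
  rw [key _ (rearrange_nonneg a), key _ ha0]
  congr 1
  refine setLIntegral_congr_fun measurableSet_Ioi fun t ht => ?_
  rw [Measure.count_apply MeasurableSet.of_discrete,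
    Measure.count_apply (MeasurableSet.of_discrete),
    encard_lt_rearrange ha (le_of_lt ht)]

/-- The additive form avoids subtraction in `ℝ≥0∞`. -/
theorem powSum_update (p : ℝ) (z : ℕ → ℝ) (i : ℕ) (v : ℝ) :
    powSum p (Function.update z i v) + ENNReal.ofReal (z i ^ p) =
      powSum p z + ENNReal.ofReal (v ^ p) := by
  unfold powSum
  rw [ENNReal.tsum_eq_add_tsum_ite i,
    ENNReal.tsum_eq_add_tsum_ite (f := fun k => ENNReal.ofReal (z k ^ p)) i]
  rw [Function.update_self, add_right_comm, add_right_comm (ENNReal.ofReal (z i ^ p)),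
    add_comm (ENNReal.ofReal (z i ^ p)) (ENNReal.ofReal (v ^ p))]
  congr 2
  ext k
  split_ifs with h <;> simp [h]

/-! ### Power sums of configurations, and their change under merging and splitting. -/

theorem Config.le_sum {z : ℕ → ℝ} (hz : z ∈ Config) (i : ℕ) : z i ≤ ∑' k, z k :=
  hz.2.2.le_tsum i fun k _ => hz.2.1 k

theorem Config.summable_rpow {z : ℕ → ℝ} (hz : z ∈ Config) {p : ℝ} (hp : 1 ≤ p) :
    Summable fun i => z i ^ p := by
  refine Summable.of_nonneg_of_le (fun i => Real.rpow_nonneg (hz.2.1 i) p) (fun i => ?_)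
    (hz.2.2.mul_left ((∑' k, z k) ^ (p - 1)))
  have h : z i ^ p = z i ^ (p - 1) * z i := by
    rw [← Real.rpow_add_one' (hz.2.1 i) (by linarith)]
    ring_nf
  rw [h]
  exact mul_le_mul_of_nonneg_right
    (Real.rpow_le_rpow (hz.2.1 i) (Config.le_sum hz i) (by linarith)) (hz.2.1 i)

theorem Config.powSum_eq {z : ℕ → ℝ} (hz : z ∈ Config) {p : ℝ} (hp : 1 ≤ p) :
    powSum p z = ENNReal.ofReal (∑' i, z i ^ p) :=
  (ENNReal.ofReal_tsum_of_nonneg (fun i => Real.rpow_nonneg (hz.2.1 i) p)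
    (Config.summable_rpow hz hp)).symm

theorem Config.powSum_ne_top {z : ℕ → ℝ} (hz : z ∈ Config) {p : ℝ} (hp : 1 ≤ p) :
    powSum p z ≠ ∞ := by
  simp [Config.powSum_eq hz hp]

theorem Config.toReal_powSum {z : ℕ → ℝ} (hz : z ∈ Config) {p : ℝ} (hp : 1 ≤ p) :
    (powSum p z).toReal = ∑' i, z i ^ p := by
  rw [Config.powSum_eq hz hp,
    ENNReal.toReal_ofReal (tsum_nonneg fun i => Real.rpow_nonneg (hz.2.1 i) p)]

theorem Config.bddAbove {z : ℕ → ℝ} (hz : z ∈ Config) : BddAbove (range z) :=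
  ⟨∑' k, z k, by rintro _ ⟨i, rfl⟩; exact Config.le_sum hz i⟩

theorem bddAbove_range_update {z : ℕ → ℝ} (hz : BddAbove (range z)) (i : ℕ) (v : ℝ) :
    BddAbove (range (Function.update z i v)) := by
  obtain ⟨B, hB⟩ := hz
  refine ⟨max B v, ?_⟩
  rintro _ ⟨k, rfl⟩
  by_cases h : k = i
  · subst h; simp
  · rw [Function.update_of_ne h]
    exact (hB ⟨k, rfl⟩).trans (le_max_left _ _)

theorem update_nonneg {z : ℕ → ℝ} (hz : ∀ k, 0 ≤ z k) (i : ℕ) {v : ℝ} (hv : 0 ≤ v) (k : ℕ) :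
    0 ≤ Function.update z i v k := by
  by_cases h : k = i
  · subst h; simpa
  · simpa [Function.update_of_ne h] using hz k

theorem powSum_merge {p : ℝ} (hp : 0 < p) {z : ℕ → ℝ} (hz : z ∈ Config) {i j : ℕ} (hij : i ≠ j) :
    powSum p (merge i j z) + (ENNReal.ofReal (z i ^ p) + ENNReal.ofReal (z j ^ p)) =
      powSum p z + ENNReal.ofReal ((z i + z j) ^ p) := by
  have hi := hz.2.1 i
  have hj := hz.2.1 j
  unfold merge
  rw [powSum_rearrange hp
    (bddAbove_range_update (bddAbove_range_update (Config.bddAbove hz) _ _) _ _)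
    (update_nonneg (update_nonneg hz.2.1 _ (add_nonneg hi hj)) _ le_rfl)]
  have h1 := powSum_update p (Function.update z i (z i + z j)) j 0
  have h2 := powSum_update p z i (z i + z j)
  rw [Function.update_of_ne hij.symm, Real.zero_rpow hp.ne', ENNReal.ofReal_zero, add_zero] at h1
  rw [add_comm (ENNReal.ofReal (z i ^ p)), ← add_assoc, h1, h2]

theorem powSum_split {p : ℝ} (hp : 0 < p) {z : ℕ → ℝ} (hz : z ∈ Config) {i : ℕ} {y : ℝ}
    (hy : y ∈ Icc 0 (z i)) :
    powSum p (split i y z) + ENNReal.ofReal (z i ^ p) =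
      powSum p z + (ENNReal.ofReal (y ^ p) + ENNReal.ofReal ((z i - y) ^ p)) := by
  have hnn := update_nonneg hz.2.1 i (sub_nonneg.mpr hy.2)
  obtain ⟨B, hB⟩ := bddAbove_range_update (Config.bddAbove hz) i (z i - y)
  unfold split
  rw [powSum_rearrange hp]
  · have h2 := powSum_update p z i (z i - y)
    have h1 : powSum p (fun k => Nat.casesOn k y (Function.update z i (z i - y))) =
        ENNReal.ofReal (y ^ p) + powSum p (Function.update z i (z i - y)) :=
      tsum_eq_zero_add' ENNReal.summable
    rw [h1, add_assoc, h2]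
    ring
  · refine ⟨max B y, ?_⟩
    rintro _ ⟨k, rfl⟩
    cases k with
    | zero => exact le_max_right _ _
    | succ k => exact (hB ⟨k, rfl⟩).trans (le_max_left _ _)
  · intro k
    cases k with
    | zero => exact hy.1
    | succ k => exact hnn k

theorem toReal_powSum_merge {p : ℝ} (hp : 1 ≤ p) {z : ℕ → ℝ} (hz : z ∈ Config) {i j : ℕ}
    (hij : i ≠ j) : (powSum p (merge i j z)).toReal =
      (powSum p z).toReal + ((z i + z j) ^ p - z i ^ p - z j ^ p) := by
  have h := powSum_merge (zero_lt_one.trans_le hp) hz hij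
  have hi := hz.2.1 i
  have hj := hz.2.1 j
  have hfin : powSum p (merge i j z) ≠ ∞ := by
    intro htop
    rw [htop, top_add] at h
    exact ENNReal.add_ne_top.mpr ⟨Config.powSum_ne_top hz hp, ENNReal.ofReal_ne_top⟩ h.symm
  have h' := congrArg ENNReal.toReal h
  rw [ENNReal.toReal_add hfin (by simp), ENNReal.toReal_add (by simp) (by simp),
    ENNReal.toReal_add (Config.powSum_ne_top hz hp) (by simp),
    ENNReal.toReal_ofReal (by positivity), ENNReal.toReal_ofReal (by positivity),
    ENNReal.toReal_ofReal (by positivity)] at h'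
  linarith

theorem toReal_powSum_split {p : ℝ} (hp : 1 ≤ p) {z : ℕ → ℝ} (hz : z ∈ Config) {i : ℕ} {y : ℝ}
    (hy : y ∈ Icc 0 (z i)) : (powSum p (split i y z)).toReal =
      (powSum p z).toReal + (y ^ p + (z i - y) ^ p - z i ^ p) := by
  have h := powSum_split (zero_lt_one.trans_le hp) hz hy
  have hi := hz.2.1 i
  have hy1 := hy.1
  have hy2 := sub_nonneg.mpr hy.2
  have hfin : powSum p (split i y z) ≠ ∞ := by
    intro htop
    rw [htop, top_add] at h
    exact ENNReal.add_ne_top.mpr ⟨Config.powSum_ne_top hz hp, by simp⟩ h.symm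
  have h' := congrArg ENNReal.toReal h
  rw [ENNReal.toReal_add hfin (by simp),
    ENNReal.toReal_add (Config.powSum_ne_top hz hp) (by simp),
    ENNReal.toReal_add (by simp) (by simp),
    ENNReal.toReal_ofReal (by positivity), ENNReal.toReal_ofReal (by positivity),
    ENNReal.toReal_ofReal (by positivity)] at h'
  linarith

theorem powSum_one_merge {z : ℕ → ℝ} (hz : z ∈ Config) {i j : ℕ} (hij : i ≠ j) :
    powSum 1 (merge i j z) = powSum 1 z := by
  have h := powSum_merge one_pos hz hij
  simp only [Real.rpow_one] at h
  rw [ENNReal.ofReal_add (hz.2.1 i) (hz.2.1 j)] at h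
  exact (ENNReal.add_left_inj (by simp)).mp h

theorem powSum_one_split {z : ℕ → ℝ} (hz : z ∈ Config) {i : ℕ} {y : ℝ} (hy : y ∈ Icc 0 (z i)) :
    powSum 1 (split i y z) = powSum 1 z := by
  have h := powSum_split one_pos hz hy
  simp only [Real.rpow_one] at h
  rw [← ENNReal.ofReal_add hy.1 (sub_nonneg.mpr hy.2), add_sub_cancel] at h
  exact (ENNReal.add_left_inj (by simp)).mp h

end CoagFrag

namespace CoagFrag

/-! ### Poisson means, and moments as power sums. -/

theorem lintegral_natCast_poissonMeasure (r : ℝ≥0) :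
    ∫⁻ k : ℕ, (k : ℝ≥0∞) ∂(poissonMeasure r) = r := by
  rw [poissonMeasure, lintegral_sum_measure]
  simp only [lintegral_smul_measure, lintegral_dirac, smul_eq_mul]
  rw [tsum_eq_zero_add' ENNReal.summable]
  have h : ∀ n : ℕ, ENNReal.ofReal (Real.exp (-r) * r ^ (n + 1) / ((n + 1).factorial : ℝ)) *
      ((n + 1 : ℕ) : ℝ≥0∞) =
      ENNReal.ofReal (Real.exp (-r) * r ^ n / (n.factorial : ℝ)) * r := by
    intro n
    rw [← ENNReal.ofReal_natCast, ← ENNReal.ofReal_coe_nnreal (p := r),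
      ← ENNReal.ofReal_mul (by positivity), ← ENNReal.ofReal_mul (by positivity)]
    congr 1
    rw [Nat.factorial_succ]
    push_cast
    field_simp
    ring
  simp only [h, ENNReal.tsum_mul_right]
  rw [← ENNReal.ofReal_tsum_of_nonneg (fun n => by positivity)
    (hasSum_one_poissonMeasure r).summable, (hasSum_one_poissonMeasure r).tsum_eq]
  simp

theorem IsPoissonProcess.lintegral_apply {W : Type*} [MeasurableSpace W] {ξ : W → Measure Pos}
    {m : Measure Pos} {P : Measure W} (h : IsPoissonProcess ξ m P) {B : Set Pos}
    (hB : MeasurableSet B) (hm : m B ≠ ∞) : ∫⁻ w, ξ w B ∂P = m B := by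
  have h1 : ∫⁻ w, ξ w B ∂P = ∫⁻ x, x ∂(P.map fun w => ξ w B) := by
    rw [lintegral_map (g := fun w => ξ w B) measurable_id'
      ((Measure.measurable_coe hB).comp h.measurable)]
  rw [h1, h.law B hB hm, lintegral_map measurable_id' (measurable_of_countable _),
    lintegral_natCast_poissonMeasure, ENNReal.coe_toNNReal hm]

/-- The law is prescribed only on sets of finite mean measure, so a general set is exhausted by its
intersections with the spanning sets. -/
theorem IsPoissonProcess.bind_eq {W : Type*} [MeasurableSpace W] {ξ : W → Measure Pos}
    {m : Measure Pos} [SigmaFinite m] {P : Measure W} (h : IsPoissonProcess ξ m P) :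
    P.bind ξ = m := by
  ext B hB
  have hU : B = ⋃ n, B ∩ spanningSets m n := by
    rw [← inter_iUnion, iUnion_spanningSets, inter_univ]
  have hmono : Monotone fun n => B ∩ spanningSets m n :=
    fun i j hij => inter_subset_inter_right _ (monotone_spanningSets m hij)
  rw [hU, hmono.measure_iUnion, hmono.measure_iUnion]
  congr 1
  ext n
  have hBn : MeasurableSet (B ∩ spanningSets m n) := hB.inter (measurableSet_spanningSets m n)
  rw [Measure.bind_apply hBn h.measurable.aemeasurable]
  exact h.lintegral_apply hBn
    ((measure_mono inter_subset_right).trans_lt (measure_spanningSets_lt_top m n)).ne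

/-- **Campbell's formula** for the mean of a linear statistic of a Poisson process. -/
theorem IsPoissonProcess.lintegral_lintegral {W : Type*} [MeasurableSpace W]
    {ξ : W → Measure Pos} {m : Measure Pos} [SigmaFinite m] {P : Measure W}
    (h : IsPoissonProcess ξ m P) {f : Pos → ℝ≥0∞} (hf : Measurable f) :
    ∫⁻ w, ∫⁻ x, f x ∂ξ w ∂P = ∫⁻ x, f x ∂m := by
  rw [← Measure.lintegral_bind h.measurable.aemeasurable hf.aemeasurable, h.bind_eq]

theorem moment_pointMeasure {p : ℝ} (hp : 0 < p) {z : ℕ → ℝ} (hz : ∀ i, 0 ≤ z i) :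
    moment p (pointMeasure z) = powSum p z := by
  unfold moment pointMeasure powSum
  rw [lintegral_subtype_comap measurableSet_Ioi (fun y : ℝ => ENNReal.ofReal (y ^ p)),
    ← lintegral_indicator measurableSet_Ioi, lintegral_sum_measure]
  refine tsum_congr fun i => ?_
  rw [lintegral_dirac]
  rcases (hz i).eq_or_lt with h | h
  · simp [← h, Real.zero_rpow hp.ne']
  · simp [h]

theorem moment_empirical {N : ℕ} (hN : 1 ≤ N) {z : ℕ → ℝ} (hz : ∀ i, 0 ≤ z i) {γ : ℝ}
    (hγ : 0 ≤ γ) : moment γ (empirical N z) = powSum (γ + 1) z / N := by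
  have hN0 : (0 : ℝ) < N := by exact_mod_cast hN
  unfold moment empirical powSum
  rw [lintegral_subtype_comap measurableSet_Ioi (fun y : ℝ => ENNReal.ofReal (y ^ γ)),
    ← lintegral_indicator measurableSet_Ioi, lintegral_sum_measure, div_eq_mul_inv,
    ← ENNReal.tsum_mul_right]
  refine tsum_congr fun i => ?_
  rw [lintegral_smul_measure, lintegral_dirac, ← div_eq_mul_inv, smul_eq_mul]
  rcases (hz i).eq_or_lt with h | h
  · rw [← h, Real.zero_rpow (by positivity)]
    simp
  · rw [indicator_of_mem (show z i ∈ Ioi 0 from h), ← ENNReal.ofReal_mul (by positivity),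
      ← ENNReal.ofReal_natCast, ← ENNReal.ofReal_div_of_pos hN0, Real.rpow_add_one h.ne']
    congr 1
    ring

theorem empirical_univ {N : ℕ} (hN : 1 ≤ N) {z : ℕ → ℝ} (hz : ∀ i, 0 ≤ z i) :
    empirical N z univ = powSum 1 z / N := by
  have := moment_empirical hN hz le_rfl
  simpa [moment] using this

/-! ### Maximal inequality in continuous time. -/

theorem IsStepPath.exists_eq_of_mem_Ico {S : Type*} {x : ℝ≥0 → S} (hx : IsStepPath x) (t : ℝ≥0) :
    ∃ u, t < u ∧ ∀ s ∈ Ico t u, x s = x t := by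
  classical
  obtain ⟨τ, -, h0, htop, hτ⟩ := hx
  have hex : ∃ n, t < τ n := (htop.eventually_gt_atTop t).exists
  obtain ⟨n, hn⟩ : ∃ n, Nat.find hex = n + 1 := by
    refine Nat.exists_eq_succ_of_ne_zero fun h => ?_
    have := Nat.find_spec hex
    rw [h, h0] at this
    exact not_lt_zero this
  have h1 : t < τ (n + 1) := hn ▸ Nat.find_spec hex
  have h2 : τ n ≤ t := not_lt.mp (Nat.find_min hex (by omega))
  refine ⟨τ (n + 1), h1, fun s hs => ?_⟩
  rw [hτ n s ⟨h2.trans hs.1, hs.2⟩, hτ n t ⟨h2, h1⟩]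

theorem integral_martingale_eq {W : Type*} {mW : MeasurableSpace W}
    {P : Measure W} [IsFiniteMeasure P] {ℱ : Filtration ℝ≥0 mW} {M : ℝ≥0 → W → ℝ}
    (hM : Martingale M ℱ P) (t : ℝ≥0) : ∫ w, M t w ∂P = ∫ w, M 0 w ∂P := by
  have := hM.setIntegral_eq (zero_le (a := t)) (MeasurableSet.univ (α := W))
  simpa using this.symm

/-- Sampling times `k / (n + 1)`, capped at `T`. -/
noncomputable def gridTime (T : ℝ≥0) (n k : ℕ) : ℝ≥0 := min (k / (n + 1)) T

theorem gridTime_mono (T : ℝ≥0) (n : ℕ) : Monotone (gridTime T n) := fun i j hij => by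
  unfold gridTime
  gcongr

theorem eventually_exists_gridTime_mem_Ico {t u T : ℝ≥0} (htu : t < u) (htT : t < T) :
    ∀ᶠ n : ℕ in atTop, ∃ k ≤ (n + 1) * ⌈T⌉₊, gridTime T n k ∈ Ico t u := by
  have hlt : t < min u T := lt_min htu htT
  have hpos : (0 : ℝ) < ((min u T : ℝ≥0) : ℝ) - t := sub_pos.mpr (by exact_mod_cast hlt)
  filter_upwards [tendsto_one_div_add_atTop_nhds_zero_nat.eventually (gt_mem_nhds hpos)] with n hn
  have hn1 : (0 : ℝ) < (n : ℝ) + 1 := by positivity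
  refine ⟨⌈t * (n + 1)⌉₊, ?_, ?_⟩
  · refine Nat.ceil_le.mpr ?_
    push_cast
    rw [mul_comm]
    gcongr
    exact htT.le.trans (Nat.le_ceil T)
  · have h1 : t ≤ (⌈t * (n + 1)⌉₊ : ℝ≥0) / (n + 1) := by
      rw [le_div_iff₀ (by positivity)]
      exact Nat.le_ceil _
    have h2 : (⌈t * (n + 1)⌉₊ : ℝ≥0) / (n + 1) < min u T := by
      rw [← NNReal.coe_lt_coe]
      have h3 : ((⌈t * (n + 1)⌉₊ : ℝ≥0) : ℝ) < t * (n + 1) + 1 := by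
        exact_mod_cast Nat.ceil_lt_add_one (zero_le (a := t * ((n : ℝ≥0) + 1)))
      have h4 : ((⌈t * (n + 1)⌉₊ : ℝ≥0) : ℝ) / (n + 1) < t + 1 / (n + 1) := by
        rw [div_lt_iff₀ hn1]
        field_simp
        linarith
      push_cast at hn h4 ⊢
      linarith
    unfold gridTime
    rw [min_eq_left (h2.le.trans (min_le_right _ _))]
    exact ⟨h1, h2.trans_le (min_le_left _ _)⟩

/-- Doob's discrete maximal inequality along the grid; capping the times at `T` keeps them where `M`
is nonnegative. -/
theorem measure_exists_grid_le {W : Type*} {mW : MeasurableSpace W}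
    {P : Measure W} [IsFiniteMeasure P] {ℱ : Filtration ℝ≥0 mW} {M : ℝ≥0 → W → ℝ}
    (hM : Martingale M ℱ P) {T : ℝ≥0} (hnn : ∀ t ≤ T, ∀ w, 0 ≤ M t w) (n K : ℕ) :
    P {w | ∃ k ≤ K, 1 ≤ M (gridTime T n k) w} ≤ ENNReal.ofReal (∫ w, M 0 w ∂P) := by
  let 𝒢 : Filtration ℕ mW := ⟨fun k => ℱ (gridTime T n k),
    fun i j hij => ℱ.mono (gridTime_mono T n hij), fun k => ℱ.le _⟩
  have hf : Martingale (fun k => M (gridTime T n k)) 𝒢 P :=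
    ⟨fun k => hM.1 _, fun i j hij => hM.2 _ _ (gridTime_mono T n hij)⟩
  have hnn' : ∀ k w, 0 ≤ M (gridTime T n k) w := fun k w => hnn _ (min_le_right _ _) w
  have h := maximal_ineq hf.submartingale (fun k w => hnn' k w) (ε := 1) K
  simp only [ENNReal.coe_one, one_mul, NNReal.coe_one] at h
  refine (measure_mono ?_).trans (h.trans (ENNReal.ofReal_le_ofReal ?_))
  · rintro w ⟨k, hk, hkM⟩
    exact hkM.trans (Finset.le_sup' (fun k => M (gridTime T n k) w)
      (Finset.mem_range.mpr (Nat.lt_succ_of_le hk)))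
  · refine (setIntegral_le_integral (hf.integrable K) (Eventually.of_forall (hnn' K))).trans ?_
    exact (integral_martingale_eq hM _).le

/-- A maximal inequality in continuous time: a right-continuous step process dominated by a
nonnegative martingale. -/
theorem measure_exists_one_le_le {W S : Type*} {mW : MeasurableSpace W}
    {P : Measure W} [IsFiniteMeasure P] {ℱ : Filtration ℝ≥0 mW} {M : ℝ≥0 → W → ℝ}
    (hM : Martingale M ℱ P) {T T' : ℝ≥0} (hT : T < T') {X : ℝ≥0 → W → S}
    (hX : ∀ w, IsStepPath fun t => X t w) {Φ : S → ℝ} (hΦ : ∀ t w, 0 ≤ Φ (X t w))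
    (hle : ∀ t ≤ T', ∀ w, Φ (X t w) ≤ M t w) :
    P {w | ∃ t ≤ T, 1 ≤ Φ (X t w)} ≤ ENNReal.ofReal (∫ w, M 0 w ∂P) := by
  let E : ℕ → Set W := fun n => {w | ∃ k ≤ (n + 1) * ⌈T'⌉₊, 1 ≤ M (gridTime T' n k) w}
  -- The grids are not nested, so the `E n` need not increase. The sets `A m` do, and each lies in
  -- `E m`, so the bound passes to their union. The gap `T < T'` leaves room for a grid point to the
  -- right of `t` even when `t = T`.
  let A : ℕ → Set W := fun m => {w | ∀ n, m ≤ n → w ∈ E n}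
  have hA : Monotone A := fun i j hij w hw n hn => hw n (hij.trans hn)
  have hsub : {w | ∃ t ≤ T, 1 ≤ Φ (X t w)} ⊆ ⋃ m, A m := by
    rintro w ⟨t, htT, ht⟩
    obtain ⟨u, htu, hu⟩ := (hX w).exists_eq_of_mem_Ico t
    obtain ⟨m, hm⟩ := eventually_atTop.mp
      (eventually_exists_gridTime_mem_Ico htu (htT.trans_lt hT))
    refine mem_iUnion.mpr ⟨m, fun n hn => ?_⟩
    obtain ⟨k, hk, hkI⟩ := hm n hn
    refine ⟨k, hk, ?_⟩
    have hXeq : X (gridTime T' n k) w = X t w := hu _ hkI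
    calc 1 ≤ Φ (X (gridTime T' n k) w) := by rwa [hXeq]
      _ ≤ _ := hle _ (min_le_right _ _) w
  refine (measure_mono hsub).trans ?_
  rw [hA.measure_iUnion]
  refine iSup_le fun m => (measure_mono (fun w (hw : w ∈ A m) => hw m le_rfl)).trans
    (measure_exists_grid_le hM (fun t ht w => (hΦ t w).trans (hle t ht w)) m _)

/-- No integrability is needed: the integral of a non-integrable function is `0` by convention, and
`0 ≤ c * t`. -/
theorem intervalIntegral_le_of_le {G : ℝ → ℝ} {c t : ℝ} (hc : 0 ≤ c) (ht : 0 ≤ t)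
    (hG : ∀ s, G s ≤ c) : ∫ s in (0 : ℝ)..t, G s ≤ c * t := by
  by_cases hi : IntervalIntegrable G volume 0 t
  · calc ∫ s in (0 : ℝ)..t, G s ≤ ∫ _s in (0 : ℝ)..t, c :=
        intervalIntegral.integral_mono_on ht hi (by simp) fun s _ => hG s
      _ = c * t := by simp [mul_comm]
  · rw [intervalIntegral.integral_undef hi]
    positivity

theorem IsCoagFragProcess.measure_exists_one_le_le {W : Type*} {mW : MeasurableSpace W} {N : ℕ}
    {Hh Hc : ℝ → ℝ → ℝ} {ℱ : Filtration ℝ≥0 mW} {P : Measure W} [IsProbabilityMeasure P]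
    {Z : ℝ≥0 → W → ℕ → ℝ} (hZ : IsCoagFragProcess N Hh Hc ℱ P Z) {Φ : (ℕ → ℝ) → ℝ}
    (hΦm : Measurable Φ) (hΦ0 : ∀ z, 0 ≤ Φ z) (hΦb : ∃ C, ∀ z ∈ Config, |Φ z| ≤ C)
    (hgb : ∃ C, ∀ z ∈ Config, |gen N Hh Hc Φ z| ≤ C) {c : ℝ} (hc : 0 ≤ c)
    (hgc : ∀ z ∈ Config, gen N Hh Hc Φ z ≤ c) (T : ℝ≥0) :
    P {w | ∃ t ≤ T, 1 ≤ Φ (Z t w)} ≤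
      ∫⁻ w, ENNReal.ofReal (Φ (Z 0 w)) ∂P + ENNReal.ofReal (c * (T + 1)) := by
  have hm0 : Measurable[ℱ 0] fun w => Φ (Z 0 w) := hΦm.comp (hZ.adapted 0)
  have hm : Measurable fun w => Φ (Z 0 w) := hm0.mono (ℱ.le 0) le_rfl
  have hint : Integrable (fun w => Φ (Z 0 w)) P := by
    obtain ⟨C, hC⟩ := hΦb
    exact Integrable.of_bound hm.aestronglyMeasurable C
      (Eventually.of_forall fun w => hC _ (hZ.mem_config 0 w))
  -- Adding this constant-in-time martingale compensates the drift, whose integral up to any time `t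
  -- ≤ T + 1` is at most `c * (T + 1)`; the sum dominates `Φ (Z t)` there.
  have hstart : Martingale (fun (_ : ℝ≥0) w => Φ (Z 0 w) + c * (T + 1)) ℱ P := by
    refine martingale_const_fun ℱ P ?_ (hint.add (integrable_const _))
    exact (hm0.add_const _).stronglyMeasurable
  have hM := hstart.add (hZ.martingale Φ hΦm hΦb hgb)
  have hlt : T < T + 1 := by simp
  refine (CoagFrag.measure_exists_one_le_le hM hlt hZ.step_path (fun t w => hΦ0 _) ?_).trans ?_
  · intro t ht w
    have h1 := intervalIntegral_le_of_le (G := fun s => gen N Hh Hc Φ (Z s.toNNReal w))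
      hc t.2 (fun s => hgc _ (hZ.mem_config _ w))
    have h2 : c * (t : ℝ) ≤ c * (T + 1) := mul_le_mul_of_nonneg_left (by exact_mod_cast ht) hc
    simp only [Pi.add_apply]
    have h3 : (t : ℝ) = t.1 := rfl
    rw [← h3] at h1
    linarith
  · have h0 : ∀ w, ((fun (_ : ℝ≥0) w => Φ (Z 0 w) + c * (T + 1)) + fun (t : ℝ≥0) w =>
        Φ (Z t w) - Φ (Z 0 w) - ∫ s in (0 : ℝ)..t, gen N Hh Hc Φ (Z s.toNNReal w)) 0 w =
        Φ (Z 0 w) + c * (T + 1) := by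
      intro w
      simp
    simp only [h0]
    rw [integral_add hint (integrable_const _), integral_const, probReal_univ, one_smul,
      ENNReal.ofReal_add (integral_nonneg fun w => hΦ0 _) (by positivity),
      ofReal_integral_eq_lintegral_ofReal hint (Eventually.of_forall fun w => hΦ0 _)]

end CoagFrag

namespace CoagFrag

/-! ### Kernel estimates and the drift of the cut-off power sum. -/

theorem IsCoagKernel.le_rpow {lam : ℝ} {H : ℝ → ℝ → ℝ} (h : IsCoagKernel lam H) {x y : ℝ}
    (hx : 0 < x) (hy : 0 < y) :
    H x y ≤ sSup ((fun u : ℝ => H u (1 - u)) '' Ioo 0 1) * (x + y) ^ lam := by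
  have hs : 0 < x + y := add_pos hx hy
  have hu : x / (x + y) ∈ Ioo (0 : ℝ) 1 := ⟨by positivity, by rw [div_lt_one hs]; linarith⟩
  have h1 : 1 - x / (x + y) = y / (x + y) := by field_simp; ring
  have h2 : H x y = (x + y) ^ lam * H (x / (x + y)) (y / (x + y)) := by
    rw [← h.homog _ _ _ hs (by positivity) (by positivity), mul_div_cancel₀ _ hs.ne',
      mul_div_cancel₀ _ hs.ne']
  rw [h2, mul_comm]
  refine mul_le_mul_of_nonneg_right ?_ (by positivity)
  rw [← h1]
  exact le_csSup h.bdd ⟨_, hu, rfl⟩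

theorem add_rpow_le_two_rpow_mul {x y α : ℝ} (hx : 0 ≤ x) (hy : 0 ≤ y) (hα : 0 ≤ α) :
    (x + y) ^ α ≤ 2 ^ α * (x ^ α + y ^ α) := by
  wlog h : y ≤ x generalizing x y
  · rw [add_comm x, add_comm (x ^ α)]
    exact this hy hx (le_of_not_ge h)
  calc (x + y) ^ α ≤ (2 * x) ^ α := Real.rpow_le_rpow (by positivity) (by linarith) hα
    _ = 2 ^ α * x ^ α := Real.mul_rpow (by norm_num) hx
    _ ≤ _ := by gcongr; linarith [Real.rpow_nonneg hy α]

/-- The rate at which binary fragmentation dissipates the power sum of order `δ`. -/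
noncomputable def fragRate (δ : ℝ) (H : ℝ → ℝ → ℝ) : ℝ :=
  ∫ u in Ioo (0 : ℝ) 1, H u (1 - u) * (1 - u ^ δ - (1 - u) ^ δ)

theorem one_sub_rpow_sub_rpow_pos {δ u : ℝ} (hδ : 1 < δ) (hu : u ∈ Ioo (0 : ℝ) 1) :
    0 < 1 - u ^ δ - (1 - u) ^ δ := by
  have h1 := Real.rpow_lt_self_of_lt_one hu.1 hu.2 hδ
  have h2 := Real.rpow_lt_self_of_lt_one (x := 1 - u) (by linarith [hu.2]) (by linarith [hu.1]) hδ
  linarith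

/-- The factor $1-u^\delta-(1-u)^\delta$ is strictly positive on $(0,1)$, so a vanishing rate would
make the kernel vanish almost everywhere, against `integral_pos`. -/
theorem IsFragKernel.fragRate_pos {lam δ : ℝ} (hδ : 1 < δ) {H : ℝ → ℝ → ℝ}
    (h : IsFragKernel lam H) : 0 < fragRate δ H := by
  have hnn : ∀ u ∈ Ioo (0 : ℝ) 1, 0 ≤ H u (1 - u) * (1 - u ^ δ - (1 - u) ^ δ) := fun u hu =>
    mul_nonneg (h.nonneg _ _ hu.1 (by linarith [hu.2])) (one_sub_rpow_sub_rpow_pos hδ hu).le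
  have hint : IntegrableOn (fun u : ℝ => H u (1 - u) * (1 - u ^ δ - (1 - u) ^ δ))
      (Ioo 0 1) := by
    refine h.integrable.mul_bdd (c := 1) (Measurable.aestronglyMeasurable (by fun_prop)) ?_
    refine (ae_restrict_iff' measurableSet_Ioo).mpr (Eventually.of_forall fun u hu => ?_)
    rw [Real.norm_of_nonneg (one_sub_rpow_sub_rpow_pos hδ hu).le]
    have h1 := Real.rpow_nonneg hu.1.le δ
    have h2 := Real.rpow_nonneg (x := 1 - u) (by linarith [hu.2]) δ
    linarith
  refine (setIntegral_nonneg measurableSet_Ioo hnn).lt_of_ne' fun h0 => ?_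
  have hae := (setIntegral_eq_zero_iff_of_nonneg_ae
    ((ae_restrict_iff' measurableSet_Ioo).mpr (Eventually.of_forall hnn)) hint).mp h0
  have hz : ∫ u in Ioo (0 : ℝ) 1, H u (1 - u) = 0 := by
    refine integral_eq_zero_of_ae ?_
    filter_upwards [hae, ae_restrict_mem measurableSet_Ioo] with u hu hmem
    exact (mul_eq_zero.mp hu).resolve_right (one_sub_rpow_sub_rpow_pos hδ hmem).ne'
  exact h.integral_pos.ne' hz

/-- Substitute $y=su$ and use homogeneity: the kernel gives $s^\lambda$, the increment $s^\delta$
and $dy$ one more factor $s$. -/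
theorem IsFragKernel.integral_split {lam δ : ℝ} {H : ℝ → ℝ → ℝ} (h : IsFragKernel lam H) {s : ℝ}
    (hs : 0 < s) : ∫ y in (0 : ℝ)..s, H y (s - y) * (y ^ δ + (s - y) ^ δ - s ^ δ) =
      -fragRate δ H * s ^ (lam + δ + 1) := by
  have h1 := intervalIntegral.integral_comp_mul_left (a := 0) (b := 1)
    (fun y => H y (s - y) * (y ^ δ + (s - y) ^ δ - s ^ δ)) hs.ne'
  rw [mul_zero, mul_one, smul_eq_mul, intervalIntegral.integral_of_le zero_le_one,
    integral_Ioc_eq_integral_Ioo] at h1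
  have h2 : ∫ u in Ioo (0 : ℝ) 1, H (s * u) (s - s * u) *
      ((s * u) ^ δ + (s - s * u) ^ δ - s ^ δ) = -(s ^ lam * s ^ δ) * fragRate δ H := by
    rw [fragRate, ← integral_const_mul]
    refine setIntegral_congr_fun measurableSet_Ioo fun u hu => ?_
    have hu' : 0 < 1 - u := by linarith [hu.2]
    have : s - s * u = s * (1 - u) := by ring
    rw [this, h.homog s u (1 - u) hs hu.1 hu', Real.mul_rpow hs.le hu.1.le,
      Real.mul_rpow hs.le hu'.le]
    ring
  rw [h2] at h1
  rw [Real.rpow_add_one hs.ne', Real.rpow_add hs]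
  field_simp at h1
  linarith

/-- The normalised power sum of order `δ`, replaced by `1` where the total mass exceeds `R`. -/
noncomputable def cutPowSum (δ R c : ℝ) (z : ℕ → ℝ) : ℝ :=
  if powSum 1 z ≤ ENNReal.ofReal R then (powSum δ z).toReal / c else 1

theorem measurable_cutPowSum (δ R c : ℝ) : Measurable (cutPowSum δ R c) :=
  Measurable.ite (measurableSet_le (measurable_powSum 1) measurable_const)
    ((measurable_powSum δ).ennreal_toReal.div_const c) measurable_const

theorem cutPowSum_nonneg (δ R : ℝ) {c : ℝ} (hc : 0 ≤ c) (z : ℕ → ℝ) : 0 ≤ cutPowSum δ R c z := by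
  unfold cutPowSum
  split_ifs <;> positivity

theorem cutPowSum_merge_sub {δ R c : ℝ} (hδ : 1 ≤ δ) {z : ℕ → ℝ} (hz : z ∈ Config)
    (hR : powSum 1 z ≤ ENNReal.ofReal R) {i j : ℕ} (hij : i ≠ j) :
    cutPowSum δ R c (merge i j z) - cutPowSum δ R c z =
      ((z i + z j) ^ δ - z i ^ δ - z j ^ δ) / c := by
  unfold cutPowSum
  rw [powSum_one_merge hz hij, if_pos hR, if_pos hR, toReal_powSum_merge hδ hz hij]
  ring

theorem cutPowSum_split_sub {δ R c : ℝ} (hδ : 1 ≤ δ) {z : ℕ → ℝ} (hz : z ∈ Config)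
    (hR : powSum 1 z ≤ ENNReal.ofReal R) {i : ℕ} {y : ℝ} (hy : y ∈ Icc 0 (z i)) :
    cutPowSum δ R c (split i y z) - cutPowSum δ R c z =
      (y ^ δ + (z i - y) ^ δ - z i ^ δ) / c := by
  unfold cutPowSum
  rw [powSum_one_split hz hy, if_pos hR, if_pos hR, toReal_powSum_split hδ hz hy]
  ring

/-- Jumps conserve mass, so beyond the cut-off the function equals `1` both before and after each
jump. -/
theorem gen_cutPowSum_of_lt {δ R c : ℝ} (N : ℕ) (Hh Hc : ℝ → ℝ → ℝ) {z : ℕ → ℝ}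
    (hz : z ∈ Config) (hR : ENNReal.ofReal R < powSum 1 z) :
    gen N Hh Hc (cutPowSum δ R c) z = 0 := by
  have h0 : cutPowSum δ R c z = 1 := if_neg hR.not_ge
  have h1 : ∀ p : ℕ × ℕ, (if p.1 = p.2 then 0 else
      z p.1 * z p.2 * Hh (z p.1) (z p.2) *
        (cutPowSum δ R c (merge p.1 p.2 z) - cutPowSum δ R c z)) = 0 := by
    intro p
    split_ifs with h
    · rfl
    · have : cutPowSum δ R c (merge p.1 p.2 z) = 1 :=
        if_neg (by rw [powSum_one_merge hz h]; exact hR.not_ge)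
      rw [this, h0]
      ring
  have h2 : ∀ i, ∫ y in (0 : ℝ)..z i,
      Hc y (z i - y) * (cutPowSum δ R c (split i y z) - cutPowSum δ R c z) = 0 := by
    intro i
    refine (intervalIntegral.integral_congr fun y hy => ?_).trans intervalIntegral.integral_zero
    rw [uIcc_of_le (hz.2.1 i)] at hy
    have : cutPowSum δ R c (split i y z) = 1 :=
      if_neg (by rw [powSum_one_split hz hy]; exact hR.not_ge)
    simp only [this, h0]
    ring
  unfold gen
  simp only [h1, h2]
  simp

theorem frag_cutPowSum {lam δ R c : ℝ} (hα : 0 < lam + δ + 2) (hδ : 1 ≤ δ) {Hc : ℝ → ℝ → ℝ}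
    (hHc : IsFragKernel lam Hc) {z : ℕ → ℝ} (hz : z ∈ Config)
    (hR : powSum 1 z ≤ ENNReal.ofReal R) (i : ℕ) :
    z i * ∫ y in (0 : ℝ)..z i,
      Hc y (z i - y) * (cutPowSum δ R c (split i y z) - cutPowSum δ R c z) =
      -(fragRate δ Hc / c) * z i ^ (lam + δ + 2) := by
  rcases (hz.2.1 i).eq_or_lt with h | h
  · rw [← h, Real.zero_rpow hα.ne']
    simp
  · have h1 : ∫ y in (0 : ℝ)..z i,
        Hc y (z i - y) * (cutPowSum δ R c (split i y z) - cutPowSum δ R c z) =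
        ∫ y in (0 : ℝ)..z i, c⁻¹ * (Hc y (z i - y) * (y ^ δ + (z i - y) ^ δ - z i ^ δ)) := by
      refine intervalIntegral.integral_congr fun y hy => ?_
      rw [uIcc_of_le h.le] at hy
      rw [cutPowSum_split_sub hδ hz hR hy]
      ring
    have h2 : z i ^ (lam + δ + 2) = z i ^ (lam + δ + 1) * z i := by
      rw [← Real.rpow_add_one h.ne']
      ring_nf
    rw [h1, intervalIntegral.integral_const_mul, hHc.integral_split h, h2]
    ring

/-- Superadditivity of $x^\delta$ gives the sign. For the upper bound, the kernel is at most
$K(x+y)^\lambda$ and the increment of the power sum at most $(x+y)^\delta$; the product splits into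
pure powers. -/
theorem coag_cutPowSum_le {lam δ R c : ℝ} (hlam : 0 ≤ lam) (hδ : 1 ≤ δ) (hc : 0 < c)
    {Hh : ℝ → ℝ → ℝ} (hHh : IsCoagKernel lam Hh) {z : ℕ → ℝ} (hz : z ∈ Config)
    (hR : powSum 1 z ≤ ENNReal.ofReal R) {i j : ℕ} (hij : i ≠ j) :
    0 ≤ z i * z j * Hh (z i) (z j) * (cutPowSum δ R c (merge i j z) - cutPowSum δ R c z) ∧
    z i * z j * Hh (z i) (z j) * (cutPowSum δ R c (merge i j z) - cutPowSum δ R c z) ≤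
      sSup ((fun u : ℝ => Hh u (1 - u)) '' Ioo 0 1) * 2 ^ (lam + δ) / c *
        (z i ^ (lam + δ + 1) * z j + z i * z j ^ (lam + δ + 1)) := by
  set K := sSup ((fun u : ℝ => Hh u (1 - u)) '' Ioo 0 1) with hK
  have hKpos : 0 < K := hHh.sup_pos
  rw [cutPowSum_merge_sub hδ hz hR hij]
  have hi0 := hz.2.1 i
  have hj0 := hz.2.1 j
  generalize z i = x at *
  generalize z j = y at *
  have hrhs : 0 ≤ K * 2 ^ (lam + δ) / c * (x ^ (lam + δ + 1) * y + x * y ^ (lam + δ + 1)) := by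
    positivity
  rcases hi0.eq_or_lt with hx | hx
  · rw [← hx] at hrhs ⊢
    simpa using hrhs
  rcases hj0.eq_or_lt with hy | hy
  · rw [← hy] at hrhs ⊢
    simpa using hrhs
  have hD0 : 0 ≤ (x + y) ^ δ - x ^ δ - y ^ δ := by
    linarith [Real.add_rpow_le_rpow_add hx.le hy.le hδ]
  have hD1 : (x + y) ^ δ - x ^ δ - y ^ δ ≤ (x + y) ^ δ := by
    linarith [Real.rpow_nonneg hx.le δ, Real.rpow_nonneg hy.le δ]
  have hH0 := hHh.nonneg x y hx hy
  have hH1 := hHh.le_rpow hx hy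
  refine ⟨by positivity, ?_⟩
  have hHD : Hh x y * ((x + y) ^ δ - x ^ δ - y ^ δ) ≤
      K * (2 ^ (lam + δ) * (x ^ (lam + δ) + y ^ (lam + δ))) := by
    calc Hh x y * ((x + y) ^ δ - x ^ δ - y ^ δ) ≤ (K * (x + y) ^ lam) * (x + y) ^ δ :=
          mul_le_mul hH1 hD1 hD0 (by positivity)
      _ = K * (x + y) ^ (lam + δ) := by rw [Real.rpow_add (by positivity)]; ring
      _ ≤ _ := mul_le_mul_of_nonneg_left
          (add_rpow_le_two_rpow_mul hx.le hy.le (by linarith)) hKpos.le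
  calc x * y * Hh x y * (((x + y) ^ δ - x ^ δ - y ^ δ) / c)
      = x * y / c * (Hh x y * ((x + y) ^ δ - x ^ δ - y ^ δ)) := by ring
    _ ≤ x * y / c * (K * (2 ^ (lam + δ) * (x ^ (lam + δ) + y ^ (lam + δ)))) :=
        mul_le_mul_of_nonneg_left hHD (by positivity)
    _ = _ := by
        rw [Real.rpow_add_one hx.ne', Real.rpow_add_one hy.ne']
        ring

/-- The fragmentation part is exact. The lower bound drops the nonnegative coagulation part and
serves only to show that the generator is bounded. -/
theorem gen_cutPowSum_bounds {lam δ R c : ℝ} (hlam : 0 ≤ lam) (hδ : 1 ≤ δ) (hc : 0 < c)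
    {Hh Hc : ℝ → ℝ → ℝ} (hHh : IsCoagKernel lam Hh) (hHc : IsFragKernel lam Hc) (N : ℕ)
    {z : ℕ → ℝ} (hz : z ∈ Config) (hR : powSum 1 z ≤ ENNReal.ofReal R) :
    -(fragRate δ Hc / (2 * c)) * ∑' i, z i ^ (lam + δ + 2) ≤ gen N Hh Hc (cutPowSum δ R c) z ∧
    gen N Hh Hc (cutPowSum δ R c) z ≤
      sSup ((fun u : ℝ => Hh u (1 - u)) '' Ioo 0 1) * 2 ^ (lam + δ) / (N * c) *
        ((∑' i, z i ^ (lam + δ + 1)) * ∑' i, z i) -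
      fragRate δ Hc / (2 * c) * ∑' i, z i ^ (lam + δ + 2) := by
  set K := sSup ((fun u : ℝ => Hh u (1 - u)) '' Ioo 0 1) with hK
  have hKpos : 0 < K := hHh.sup_pos
  set T : ℕ × ℕ → ℝ := fun p => if p.1 = p.2 then 0 else
      z p.1 * z p.2 * Hh (z p.1) (z p.2) *
        (cutPowSum δ R c (merge p.1 p.2 z) - cutPowSum δ R c z) with hT
  set B := K * 2 ^ (lam + δ) / c with hB
  have hB0 : 0 ≤ B := by positivity
  have hgen : gen N Hh Hc (cutPowSum δ R c) z = 1 / (2 * (N : ℝ)) * ∑' p, T p -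
      fragRate δ Hc / (2 * c) * ∑' i, z i ^ (lam + δ + 2) := by
    unfold gen
    simp only [frag_cutPowSum (c := c) (by linarith : 0 < lam + δ + 2) hδ hHc hz hR,
      tsum_mul_left]
    rw [← hT]
    ring
  have hp0 : ∀ i, 0 ≤ z i ^ (lam + δ + 1) := fun i => Real.rpow_nonneg (hz.2.1 i) _
  have hsp := Config.summable_rpow hz (p := lam + δ + 1) (by linarith)
  have hs := hz.2.2
  have hs1 : Summable fun p : ℕ × ℕ => z p.1 ^ (lam + δ + 1) * z p.2 :=
    hsp.mul_of_nonneg hs hp0 hz.2.1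
  have hs2 : Summable fun p : ℕ × ℕ => z p.1 * z p.2 ^ (lam + δ + 1) :=
    hs.mul_of_nonneg hsp hz.2.1 hp0
  have hT0 : ∀ p, 0 ≤ T p := by
    intro p
    simp only [hT]
    split_ifs with h
    · exact le_rfl
    · exact (coag_cutPowSum_le hlam hδ hc hHh hz hR h).1
  have hT1 : ∀ p, T p ≤ B * (z p.1 ^ (lam + δ + 1) * z p.2 + z p.1 * z p.2 ^ (lam + δ + 1)) := by
    intro p
    simp only [hT]
    split_ifs with h
    · have := hz.2.1 p.1
      have := hz.2.1 p.2
      positivity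
    · exact (coag_cutPowSum_le hlam hδ hc hHh hz hR h).2
  have hsum := (hs1.add hs2).mul_left B
  have hTs : Summable T := Summable.of_nonneg_of_le hT0 hT1 hsum
  have hTle : ∑' p, T p ≤ 2 * B * ((∑' i, z i ^ (lam + δ + 1)) * ∑' i, z i) := by
    refine (hTs.tsum_le_tsum hT1 hsum).trans_eq ?_
    rw [tsum_mul_left, hs1.tsum_add hs2, ← hsp.tsum_mul_tsum hs hs1, ← hs.tsum_mul_tsum hsp hs2]
    ring
  rw [hgen]
  constructor
  · have : 0 ≤ 1 / (2 * (N : ℝ)) * ∑' p, T p := mul_nonneg (by positivity) (tsum_nonneg hT0)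
    linarith
  · have h1 := mul_le_mul_of_nonneg_left hTle (by positivity : 0 ≤ 1 / (2 * (N : ℝ)))
    have h2 : 1 / (2 * (N : ℝ)) * (2 * B * ((∑' i, z i ^ (lam + δ + 1)) * ∑' i, z i)) =
        K * 2 ^ (lam + δ) / (N * c) * ((∑' i, z i ^ (lam + δ + 1)) * ∑' i, z i) := by
      rw [hB]
      field_simp
    linarith

theorem Config.tsum_rpow_le {z : ℕ → ℝ} (hz : z ∈ Config) {p : ℝ} (hp : 1 ≤ p) {R : ℝ}
    (hR : ∑' i, z i ≤ R) : ∑' i, z i ^ p ≤ R ^ p := by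
  have hS : 0 ≤ ∑' i, z i := tsum_nonneg hz.2.1
  have hle : ∀ i, z i ^ p ≤ R ^ (p - 1) * z i := by
    intro i
    have h : z i ^ p = z i ^ (p - 1) * z i := by
      rw [← Real.rpow_add_one' (hz.2.1 i) (by linarith)]
      ring_nf
    rw [h]
    exact mul_le_mul_of_nonneg_right
      (Real.rpow_le_rpow (hz.2.1 i) ((Config.le_sum hz i).trans hR) (by linarith)) (hz.2.1 i)
  calc ∑' i, z i ^ p ≤ ∑' i, R ^ (p - 1) * z i :=
        (Config.summable_rpow hz hp).tsum_le_tsum hle (hz.2.2.mul_left _)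
    _ = R ^ (p - 1) * ∑' i, z i := tsum_mul_left
    _ ≤ R ^ (p - 1) * R := mul_le_mul_of_nonneg_left hR (Real.rpow_nonneg (hS.trans hR) _)
    _ = R ^ p := by
        rw [← Real.rpow_add_one' (hS.trans hR) (by linarith)]
        ring_nf

/-- Termwise, split at size $\eta^{-1}$: smaller terms are controlled by the mass, larger ones by
the higher power. -/
theorem Config.tsum_rpow_interpolation {z : ℕ → ℝ} (hz : z ∈ Config) {α η : ℝ} (hα : 0 < α)
    (hη : 0 < η) : ∑' i, z i ^ (α + 1) ≤ η * ∑' i, z i ^ (α + 2) + (η⁻¹) ^ α * ∑' i, z i := by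
  have h1 := Config.summable_rpow hz (p := α + 1) (by linarith)
  have h2 := Config.summable_rpow hz (p := α + 2) (by linarith)
  rw [← tsum_mul_left, ← tsum_mul_left, ← (h2.mul_left η).tsum_add (hz.2.2.mul_left _)]
  refine h1.tsum_le_tsum (fun i => ?_) ((h2.mul_left η).add (hz.2.2.mul_left _))
  rcases (hz.2.1 i).eq_or_lt with h | h
  · rw [← h, Real.zero_rpow (by positivity), Real.zero_rpow (by positivity)]
    simp
  · have e1 : z i ^ (α + 1) = z i ^ α * z i := Real.rpow_add_one h.ne' _
    have e2 : z i ^ (α + 2) = z i ^ α * z i * z i := by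
      rw [← e1, ← Real.rpow_add_one h.ne']
      ring_nf
    rw [e1, e2]
    rcases le_total (z i) η⁻¹ with hle | hle
    · have : z i ^ α ≤ η⁻¹ ^ α := Real.rpow_le_rpow h.le hle hα.le
      have h3 : z i ^ α * z i ≤ η⁻¹ ^ α * z i := mul_le_mul_of_nonneg_right this h.le
      have h4 : 0 ≤ η * (z i ^ α * z i * z i) := by positivity
      linarith
    · have h5 : 1 ≤ η * z i := by
        rw [inv_eq_one_div, div_le_iff₀ hη] at hle
        linarith
      have h3 : z i ^ α * z i * 1 ≤ z i ^ α * z i * (η * z i) :=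
        mul_le_mul_of_nonneg_left h5 (by positivity)
      have h4 : 0 ≤ η⁻¹ ^ α * z i := by positivity
      linarith

/-- The drift of the cut-off power sum is bounded, with a bound on its positive part that is
uniform in `N`: fragmentation dominates coagulation. -/
theorem exists_gen_cutPowSum_le {lam δ : ℝ} (hlam : 0 ≤ lam) (hδ : 1 < δ)
    {Hh Hc : ℝ → ℝ → ℝ} (hHh : IsCoagKernel lam Hh) (hHc : IsFragKernel lam Hc) {A : ℝ}
    (hA : 0 < A) : ∃ C, 0 ≤ C ∧ ∀ (N : ℕ) (b : ℝ), 1 ≤ N → 0 < b →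
      (∀ z ∈ Config, gen N Hh Hc (cutPowSum δ (N * A) (N * b)) z ≤ C / b) ∧
      ∃ C', ∀ z ∈ Config, |gen N Hh Hc (cutPowSum δ (N * A) (N * b)) z| ≤ C' := by
  set K := sSup ((fun u : ℝ => Hh u (1 - u)) '' Ioo 0 1) with hK
  have hKpos : 0 < K := hHh.sup_pos
  have hκ := hHc.fragRate_pos hδ
  set κ := fragRate δ Hc with hκdef
  set α := lam + δ with hα
  have hα0 : 0 < α := by linarith
  set D := K * 2 ^ α * A with hD
  have hD0 : 0 < D := by positivity
  -- Chosen so that `D * η = κ / 2`: the higher power sum produced by the interpolation then cancels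
  -- the fragmentation loss exactly.
  set η := κ / (2 * D) with hη
  have hη0 : 0 < η := by positivity
  refine ⟨D * η⁻¹ ^ α * A, by positivity, fun N b hN hb => ?_⟩
  have hN0 : (0 : ℝ) < N := by exact_mod_cast hN
  have hc : 0 < N * b := by positivity
  have hupper : ∀ z ∈ Config, gen N Hh Hc (cutPowSum δ (N * A) (N * b)) z ≤
      D * η⁻¹ ^ α * A / b := by
    intro z hz
    rcases lt_or_ge (ENNReal.ofReal (N * A)) (powSum 1 z) with hR | hR
    · rw [gen_cutPowSum_of_lt N Hh Hc hz hR]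
      positivity
    have hS : ∑' i, z i ≤ N * A := by
      rw [Config.powSum_eq hz le_rfl] at hR
      simpa using (ENNReal.ofReal_le_ofReal_iff (by positivity)).mp hR
    have h1 := (gen_cutPowSum_bounds hlam hδ.le hc hHh hHc N hz hR).2
    have h2 := Config.tsum_rpow_interpolation hz hα0 hη0
    have hm0 : 0 ≤ ∑' i, z i ^ (α + 1) := tsum_nonneg fun i => Real.rpow_nonneg (hz.2.1 i) _
    rw [← hα, ← hK, ← hκdef] at h1
    set m1 := ∑' i, z i
    set m2 := ∑' i, z i ^ (α + 1)
    set m3 := ∑' i, z i ^ (α + 2)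
    refine h1.trans ?_
    have h3 : K * 2 ^ α / (N * (N * b)) * (m2 * m1) ≤ D / (N * b) * m2 := by
      calc K * 2 ^ α / (N * (N * b)) * (m2 * m1) ≤ K * 2 ^ α / (N * (N * b)) * (m2 * (N * A)) := by
            gcongr
        _ = D / (N * b) * m2 := by rw [hD]; field_simp
    have h4 : D / (N * b) * m2 ≤ D / (N * b) * (η * m3 + η⁻¹ ^ α * (N * A)) := by
      refine mul_le_mul_of_nonneg_left (h2.trans ?_) (by positivity)
      gcongr
    have h5 : D / (N * b) * (η * m3 + η⁻¹ ^ α * (N * A)) =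
        κ / (2 * (N * b)) * m3 + D * η⁻¹ ^ α * A / b := by
      have : D * η = κ / 2 := by rw [hη]; field_simp
      calc D / (N * b) * (η * m3 + η⁻¹ ^ α * (N * A))
          = (D * η) / (N * b) * m3 + D * η⁻¹ ^ α * A / b * (N / N) := by field_simp
        _ = _ := by rw [this, div_self hN0.ne']; field_simp
    linarith
  -- The two-sided bound may grow with `N`; it is needed only to make the test function admissible.
  refine ⟨hupper, max (D * η⁻¹ ^ α * A / b) (κ / (2 * (N * b)) * (N * A) ^ (α + 2)),
    fun z hz => abs_le.mpr ⟨?_, (hupper z hz).trans (le_max_left _ _)⟩⟩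
  rcases lt_or_ge (ENNReal.ofReal (N * A)) (powSum 1 z) with hR | hR
  · rw [gen_cutPowSum_of_lt N Hh Hc hz hR]
    have : 0 ≤ D * η⁻¹ ^ α * A / b := by positivity
    linarith [le_max_left (D * η⁻¹ ^ α * A / b) (κ / (2 * (N * b)) * (N * A) ^ (α + 2))]
  · have hS : ∑' i, z i ≤ N * A := by
      rw [Config.powSum_eq hz le_rfl] at hR
      simpa using (ENNReal.ofReal_le_ofReal_iff (by positivity)).mp hR
    have h1 := (gen_cutPowSum_bounds hlam hδ.le hc hHh hHc N hz hR).1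
    have h2 := Config.tsum_rpow_le hz (p := α + 2) (by linarith) hS
    have h3 := mul_le_mul_of_nonneg_left h2 (by positivity : 0 ≤ κ / (2 * (N * b)))
    have h4 := le_max_right (D * η⁻¹ ^ α * A / b) (κ / (2 * (N * b)) * (N * A) ^ (α + 2))
    linarith

theorem exists_abs_cutPowSum_le {δ : ℝ} (hδ : 1 ≤ δ) {R c : ℝ} (hR : 0 ≤ R) (hc : 0 < c) :
    ∃ C, ∀ z ∈ Config, |cutPowSum δ R c z| ≤ C := by
  refine ⟨max (R ^ δ / c) 1, fun z hz => ?_⟩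
  rw [abs_of_nonneg (cutPowSum_nonneg δ R hc.le z)]
  unfold cutPowSum
  split_ifs with h
  · refine le_trans ?_ (le_max_left _ _)
    rw [Config.powSum_eq hz le_rfl, ENNReal.ofReal_le_ofReal_iff hR] at h
    rw [Config.toReal_powSum hz hδ]
    gcongr
    exact Config.tsum_rpow_le hz hδ (by simpa using h)
  · exact le_max_right _ _

end CoagFrag

namespace CoagFrag

/-! ### Initial mean and conclusion. -/

/-- Markov's bound, pointwise: beyond the cut-off the first quotient already exceeds `1`. The right
side is linear in the point configuration, so Campbell's formula applies. -/
theorem ofReal_cutPowSum_le {δ R c : ℝ} (hR : 0 < R) (hc : 0 < c) (z : ℕ → ℝ) :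
    ENNReal.ofReal (cutPowSum δ R c z) ≤
      powSum 1 z / ENNReal.ofReal R + powSum δ z / ENNReal.ofReal c := by
  unfold cutPowSum
  split_ifs with h
  · rw [ENNReal.ofReal_div_of_pos hc]
    exact (ENNReal.div_le_div_right ENNReal.ofReal_toReal_le _).trans le_add_self
  · rw [ENNReal.ofReal_one]
    refine le_trans ?_ le_self_add
    rw [ENNReal.le_div_iff_mul_le (Or.inl (by simpa using hR)) (Or.inl ENNReal.ofReal_ne_top),
      one_mul]
    exact (not_le.mp h).le

theorem empirical_mem_boundedSet {N : ℕ} (hN : 1 ≤ N) {z : ℕ → ℝ} (hz : z ∈ Config)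
    {δ a b : ℝ} (hδ : 1 ≤ δ) (hb : 0 < b) (h : cutPowSum δ (N * a) (N * b) z < 1) :
    empirical N z ∈ boundedSet a b (δ - 1) := by
  have hN0 : (0 : ℝ) < N := by exact_mod_cast hN
  unfold cutPowSum at h
  split_ifs at h with hS
  · have hmass : empirical N z univ ≤ ENNReal.ofReal a := by
      rw [empirical_univ hN hz.2.1]
      refine ENNReal.div_le_of_le_mul' ?_
      rwa [ENNReal.ofReal_mul hN0.le, ENNReal.ofReal_natCast] at hS
    refine ⟨⟨hmass.trans_lt ENNReal.ofReal_lt_top⟩, hmass, ?_⟩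
    rw [moment_empirical hN hz.2.1 (by linarith), sub_add_cancel]
    refine ENNReal.div_le_of_le_mul' ?_
    rw [div_lt_one (by positivity)] at h
    rw [← ENNReal.ofReal_natCast, ← ENNReal.ofReal_mul hN0.le,
      ← ENNReal.ofReal_toReal (Config.powSum_ne_top hz hδ)]
    exact ENNReal.ofReal_le_ofReal h.le
  · exact absurd h (lt_irrefl 1)

theorem measurable_ofReal_rpow (p : ℝ) : Measurable fun y : Pos => ENNReal.ofReal ((y : ℝ) ^ p) :=
  (measurable_subtype_coe.pow_const p).ennreal_ofReal

theorem moment_lt_top_of_le {p q r : ℝ} (hpq : p ≤ q) (hqr : q ≤ r) {ν : Measure Pos}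
    (hp : moment p ν < ∞) (hr : moment r ν < ∞) : moment q ν < ∞ := by
  refine lt_of_le_of_lt ?_ (ENNReal.add_lt_top.mpr ⟨hp, hr⟩)
  unfold moment
  rw [← lintegral_add_left (measurable_ofReal_rpow p)]
  refine lintegral_mono fun y => ?_
  have hy : (0 : ℝ) < y := y.2
  rw [← ENNReal.ofReal_add (by positivity) (by positivity)]
  refine ENNReal.ofReal_le_ofReal ?_
  rcases le_total (y : ℝ) 1 with h | h
  · have := Real.rpow_le_rpow_of_exponent_ge hy h hpq
    linarith [Real.rpow_nonneg hy.le r]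
  · have := Real.rpow_le_rpow_of_exponent_le h hqr
    linarith [Real.rpow_nonneg hy.le p]

theorem lintegral_powSum {W : Type*} [MeasurableSpace W] {P : Measure W} {X : W → ℕ → ℝ}
    {N : ℕ} {c₀ : Measure Pos} [IsLocallyFiniteMeasure c₀]
    (h : IsPoissonProcess (fun w => pointMeasure (X w)) ((N : ℝ≥0∞) • c₀) P)
    (hX : ∀ w i, 0 ≤ X w i) {p : ℝ} (hp : 0 < p) :
    ∫⁻ w, powSum p (X w) ∂P = N * moment p c₀ := by
  have hσ : SigmaFinite ((N : ℝ≥0∞) • c₀) := by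
    have : (N : ℝ≥0∞) • c₀ = (N : ℝ≥0) • c₀ := by
      ext s
      simp [ENNReal.smul_def]
    rw [this]
    infer_instance
  have := h.lintegral_lintegral (measurable_ofReal_rpow p)
  rw [lintegral_smul_measure, smul_eq_mul] at this
  rw [moment, ← this]
  exact lintegral_congr fun w => (moment_pointMeasure hp (hX w)).symm

end CoagFrag

theorem proposition5p3 (lam δ : ℝ) (hlam : 0 ≤ lam) (hδ : 1 < δ)
    (Hh Hc : ℝ → ℝ → ℝ)
    (hHh : CoagFrag.IsCoagKernel lam Hh) (hHc : CoagFrag.IsFragKernel lam Hc)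
    (c₀ : Measure CoagFrag.Pos) [IsLocallyFiniteMeasure c₀]
    (hc₀_pos : 0 < CoagFrag.moment 1 c₀) (hc₀_one : CoagFrag.moment 1 c₀ < ∞)
    (hc₀_moment : CoagFrag.moment (2 + lam + δ) c₀ < ∞)
    {W : ℕ → Type*} {mW : ∀ N, MeasurableSpace (W N)}
    (P : ∀ N, Measure (W N)) [∀ N, IsProbabilityMeasure (P N)]
    (ℱ : ∀ N, Filtration ℝ≥0 (mW N)) (Z : ∀ N, ℝ≥0 → W N → ℕ → ℝ)
    (hZ : ∀ N, 1 ≤ N → CoagFrag.IsCoagFragProcess N Hh Hc (ℱ N) (P N) (Z N))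
    (hZ₀ : ∀ N : ℕ, 1 ≤ N →
      CoagFrag.IsPoissonProcess (fun w => CoagFrag.pointMeasure (Z N 0 w))
        ((N : ℝ≥0∞) • c₀) (P N)) :
    ∀ T : ℝ, 0 < T → ∀ ε : ℝ, 0 < ε → ε < 1 →
      ∃ a b : ℝ, 0 < a ∧ 0 < b ∧ ∀ N : ℕ, 1 ≤ N →
        ENNReal.ofReal (1 - ε) ≤
          P N {w | ∀ t : ℝ≥0, (t : ℝ) ≤ T →
            CoagFrag.empirical N (Z N t w) ∈ CoagFrag.boundedSet a b (δ - 1)} := by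
  intro T hT ε hε _
  have hδmom := CoagFrag.moment_lt_top_of_le hδ.le (by linarith : δ ≤ 2 + lam + δ)
    hc₀_one hc₀_moment
  set m1 := (CoagFrag.moment 1 c₀).toReal with hm1
  set m2 := (CoagFrag.moment δ c₀).toReal with hm2
  have hm1' : CoagFrag.moment 1 c₀ = ENNReal.ofReal m1 := (ENNReal.ofReal_toReal hc₀_one.ne).symm
  have hm2' : CoagFrag.moment δ c₀ = ENNReal.ofReal m2 := (ENNReal.ofReal_toReal hδmom.ne).symm
  have hm1pos : 0 < m1 := ENNReal.toReal_pos hc₀_pos.ne' hc₀_one.ne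
  have hm2nn : 0 ≤ m2 := ENNReal.toReal_nonneg
  -- Half of `ε` pays for excess initial mass. `A` comes first because `C` depends on it, but not on
  -- `N` or `b`.
  set A := 2 * m1 / ε with hA
  have hA0 : 0 < A := by positivity
  obtain ⟨C, hC0, hC⟩ := CoagFrag.exists_gen_cutPowSum_le hlam hδ hHh hHc hA0
  -- The other half of `ε` pays for the initial moment and the drift over $[0,T+1]$.
  set b := 2 * (m2 + C * (T + 1) + 1) / ε with hb
  have hb0 : 0 < b := by positivity
  refine ⟨A, b, hA0, hb0, fun N hN => ?_⟩
  have hN0 : (0 : ℝ) < N := by exact_mod_cast hN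
  obtain ⟨hgen, hgen'⟩ := hC N b hN hb0
  set Φ := CoagFrag.cutPowSum δ (N * A) (N * b) with hΦ
  have hbad := (hZ N hN).measure_exists_one_le_le (CoagFrag.measurable_cutPowSum _ _ _)
    (CoagFrag.cutPowSum_nonneg δ _ (by positivity : 0 ≤ N * b))
    (CoagFrag.exists_abs_cutPowSum_le hδ.le (by positivity) (by positivity)) hgen'
    (by positivity : 0 ≤ C / b) hgen T.toNNReal
  rw [Real.coe_toNNReal _ hT.le] at hbad
  have hinit : ∫⁻ w, ENNReal.ofReal (Φ (Z N 0 w)) ∂(P N) ≤ ENNReal.ofReal (m1 / A + m2 / b) := by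
    have hmeas : Measurable fun w => CoagFrag.powSum 1 (Z N 0 w) / ENNReal.ofReal (N * A) :=
      ((CoagFrag.measurable_powSum 1).comp
        (((hZ N hN).adapted 0).mono ((ℱ N).le 0) le_rfl)).div_const _
    have hX : ∀ w i, 0 ≤ Z N 0 w i := fun w => ((hZ N hN).mem_config 0 w).2.1
    refine (lintegral_mono fun w => CoagFrag.ofReal_cutPowSum_le
      (by positivity : 0 < N * A) (by positivity : 0 < N * b) (Z N 0 w)).trans ?_
    rw [lintegral_add_left hmeas]
    simp only [div_eq_mul_inv]
    rw [lintegral_mul_const' _ _ (ENNReal.inv_ne_top.mpr (ENNReal.ofReal_pos.mpr (by positivity)).ne'),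
      lintegral_mul_const' _ _ (ENNReal.inv_ne_top.mpr (ENNReal.ofReal_pos.mpr (by positivity)).ne'),
      CoagFrag.lintegral_powSum (hZ₀ N hN) hX one_pos,
      CoagFrag.lintegral_powSum (hZ₀ N hN) hX (zero_lt_one.trans hδ), hm1', hm2',
      ← ENNReal.ofReal_natCast, ← ENNReal.ofReal_mul hN0.le, ← ENNReal.ofReal_mul hN0.le,
      ← ENNReal.ofReal_inv_of_pos (by positivity), ← ENNReal.ofReal_inv_of_pos (by positivity),
      ← ENNReal.ofReal_mul (by positivity), ← ENNReal.ofReal_mul (by positivity),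
      ← ENNReal.ofReal_add (by positivity) (by positivity)]
    refine ENNReal.ofReal_le_ofReal (le_of_eq ?_)
    field_simp
  have htotal : m1 / A + m2 / b + C / b * (T + 1) ≤ ε := by
    have h1 : m1 / A = ε / 2 := by rw [hA]; field_simp
    have h2 : m2 / b + C / b * (T + 1) ≤ ε / 2 := by
      have : m2 / b + C / b * (T + 1) = (m2 + C * (T + 1)) / b := by ring
      rw [this, div_le_iff₀ hb0, hb]
      field_simp
      linarith
    linarith
  have hbad' : P N {w | ∃ t ≤ T.toNNReal, 1 ≤ Φ (Z N t w)} ≤ ENNReal.ofReal ε := by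
    refine (hbad.trans (add_le_add hinit le_rfl)).trans ?_
    rw [← ENNReal.ofReal_add (by positivity) (by positivity)]
    exact ENNReal.ofReal_le_ofReal htotal
  set G := {w | ∀ t : ℝ≥0, (t : ℝ) ≤ T →
    CoagFrag.empirical N (Z N t w) ∈ CoagFrag.boundedSet A b (δ - 1)} with hG
  have hGc : Gᶜ ⊆ {w | ∃ t ≤ T.toNNReal, 1 ≤ Φ (Z N t w)} := by
    intro w hw
    by_contra hcon
    refine hw fun t ht => ?_
    refine CoagFrag.empirical_mem_boundedSet hN ((hZ N hN).mem_config t w) hδ.le hb0 ?_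
    by_contra hle
    exact hcon ⟨t, NNReal.le_toNNReal_of_coe_le ht, not_lt.mp hle⟩
  -- Subadditivity of the outer measure suffices, so measurability of `G` is not required.
  have hone : 1 ≤ P N G + P N Gᶜ := by
    rw [← measure_univ (μ := P N), ← union_compl_self G]
    exact measure_union_le _ _
  rw [ENNReal.ofReal_sub _ hε.le, ENNReal.ofReal_one]
  refine tsub_le_iff_right.mpr (hone.trans ?_)
  gcongr
  exact (measure_mono hGc).trans hbad'
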